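/- Let $\mathsf G$ be a finite connected graph (loops and multiple edges allowed) with vertex set $\mathsf V$, with a fixed orientation, and let $\mathsf E^+$ be its set of positively oriented edges. Let $\mathbb K=\mathbb R$ or $\mathbb C$ and let $k\ge 0$ be an integer. Let $\Omega_1(\mathsf G)=C_1(\mathsf G,\mathbb Z)\otimes\mathbb K$ and $\Omega^1(\mathsf G)=C^1(\mathsf G,\mathbb Z)\otimes\mathbb K$ be the spaces of $1$-chains and of $1$-cochains ($1$-forms), and let $(\cdot,\cdot)$ be the duality pairing between them and between their $k$-th exterior powers, so that $(\alpha_1\wedge\dots\wedge\alpha_k,a_1\wedge\dots\wedge a_k)=\det(\alpha_i(a_j))_{1\le i,j\le k}$. Let $\partial$ be the boundary operator, $Z_1(\cdot,\mathbb Z)=\ker\partial$ the group of integral cycles, $\delta:C^0(\mathsf G,\mathbb Z)\to C^1(\mathsf G,\mathbb Z)$ the coboundary operator, and $d=\delta\otimes\mathrm{id}_{\mathbb K}$. For a subgraph $S$ of $\mathsf G$ write $\underline x^S=\prod_{e\in \mathsf E^+(S)}x_e$. Let $\mathcal C_k(\mathsf G)$ be the set of connected spanning subgraphs $K$ such that $Z_1(K,\mathbb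 Z)$ has rank $k$; for such $K$ let $z_K$ be the exterior product of the elements of an integral basis of $Z_1(K,\mathbb Z)$ (well defined up to sign). Let $\mathcal F_{k+1}(\mathsf G)$ be the set of spanning forests of $\mathsf G$ with $k+1$ connected components; for such $F$ let $b_F$ be the exterior product of the elements of an integral basis (well defined up to sign) of the group of all $\delta f$, where $f:\mathsf V\to\mathbb Z$ is constant on each connected component of $F$. For $\vartheta\in\bigwedge^k\Omega^1(\mathsf G)$ and $\varphi\in\bigwedge^k\Omega_1(\mathsf G)$ define the polynomials in the variables $(x_e)_{e\in\mathsf E^+}$ $$\mathsf C^{(k)}_{\mathsf G}(\vartheta,\underline x)=\sum_{K\in\mathcal C_k(\mathsf G)}|(\vartheta,z_K)|^2\,\underline x^K,\qquad \mathsf A^{(k)}_{\mathsf G}(\varphi,\underline x)=\sum_{F\in\mathcal F_{k+1}(\mathsf G)}|(\varphi,b_F)|^2\,\underline x^F .$$ A polynomial is called real stable if it has real coefficients and does not vanish when every variable has strictly positive imaginary part. (i) Let $\vartheta=\theta_1\wedge\dots\wedge\theta_k$ with $\theta_1,\dots,\theta_k\in\Omega^1(\mathsf G)$. If the polynomial $\mathsf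 C^{(k)}_{\mathsf G}(\vartheta,\underline x)$ is not identically zero, then it is real stable. In particular, it is real stable (and hence non-zero) whenever $\theta_1,\dots,\theta_k$ form a basis of a $k$-dimensional subspace $\Theta$ of $\Omega^1(\mathsf G)$ with $\Theta\cap\operatorname{im}d=\{0\}$. (ii) Let $\varphi=\phi_1\wedge\dots\wedge\phi_k$ with $\phi_1,\dots,\phi_k\in\Omega_1(\mathsf G)$. If the polynomial $\mathsf A^{(k)}_{\mathsf G}(\varphi,\underline x)$ is not identically zero, then it is real stable. In particular, it is real stable (and hence non-zero) whenever $\phi_1,\dots,\phi_k$ form a basis of a $k$-dimensional subspace $\Phi$ of $\Omega_1(\mathsf G)$ with $\Phi\cap\ker(\partial\otimes\mathrm{id}_{\mathbb K})=\{0\}$. -/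

import Mathlib

/-- A finite graph (loops and multiple edges allowed) with vertex set `V`, together with a chosen
orientation: `E` is the set of positively oriented edges, one for each geometric edge, and
`e : E` runs from `src e` to `tgt e`. -/
structure OrientedGraph (V E : Type*) where
  /-- the starting vertex of a positively oriented edge -/
  src : E → V
  /-- the ending vertex of a positively oriented edge -/
  tgt : E → V

namespace OrientedGraph

variable {V E : Type*} [Fintype V] [Fintype E] [DecidableEq V] [DecidableEq E]

/-- The equivalence relation on `V` whose classes are the connected components of the spanning
subgraph `(V, S)`. -/
def componentSetoid (G : OrientedGraph V E) (S : Finset E) : Setoid V :=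
  Relation.EqvGen.setoid fun u v => ∃ e ∈ S, G.src e = u ∧ G.tgt e = v

/-- The number of connected components of the spanning subgraph `(V, S)`. -/
noncomputable def numComponents (G : OrientedGraph V E) (S : Finset E) : ℕ :=
  Nat.card (Quotient (G.componentSetoid S))

/-- The spanning subgraph `(V, S)` is connected. -/
def IsConnected (G : OrientedGraph V E) (S : Finset E) : Prop :=
  Nonempty V ∧ ∀ u v : V, G.componentSetoid S u v

/-- The boundary operator `∂ e = tgt e - src e` on `1`-chains with coefficients in `R`. A chain is
given by its coordinates in the canonical basis `E`. -/
def boundary (G : OrientedGraph V E) (R : Type*) [CommRing R] : (E → R) →ₗ[R] (V → R) where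
  toFun c := ∑ e, c e • (Pi.single (G.tgt e) 1 - Pi.single (G.src e) 1)
  map_add' a b := by simp [add_smul, Finset.sum_add_distrib]
  map_smul' r a := by simp [mul_smul, Finset.smul_sum]

/-- The coboundary operator (discrete differential) `(δ f)(e) = f (tgt e) - f (src e)`. A
`1`-cochain is given by its coordinates in the basis dual to `E`, i.e. by its values on `E`. -/
def coboundary (G : OrientedGraph V E) (R : Type*) [CommRing R] : (V → R) →ₗ[R] (E → R) where
  toFun f e := f (G.tgt e) - f (G.src e)
  map_add' a b := by ext e; simp only [Pi.add_apply]; ring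
  map_smul' r a := by ext e; simp [mul_sub]

/-- `Z₁(S, ℤ)`: the integral cycles supported in the spanning subgraph `(V, S)`. -/
def cycles (G : OrientedGraph V E) (S : Finset E) : Submodule ℤ (E → ℤ) :=
  LinearMap.ker (G.boundary ℤ) ⊓ ⨅ e ∈ {e | e ∉ S}, LinearMap.ker (LinearMap.proj e)

/-- The integer-valued functions on `V` that are constant on each connected component
of `(V, S)`. -/
def locallyConstant (G : OrientedGraph V E) (S : Finset E) : Submodule ℤ (V → ℤ) where
  carrier := {f | ∀ u v, G.componentSetoid S u v → f u = f v}
  add_mem' hf hg u v h := by simp [hf u v h, hg u v h]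
  zero_mem' _ _ _ := rfl
  smul_mem' r f hf u v h := by simp [hf u v h]

/-- `B¹(G/S, ℤ)`: the integral cuts of the graph obtained by contracting the edges of `S`, as a
submodule of the integral `1`-cochains of `G`. -/
def contractedCuts (G : OrientedGraph V E) (S : Finset E) : Submodule ℤ (E → ℤ) :=
  (G.locallyConstant S).map (G.coboundary ℤ)

/-- The first Betti number of the spanning subgraph `(V, S)`. -/
noncomputable def bettiOne (G : OrientedGraph V E) (S : Finset E) : ℕ :=
  Module.finrank ℤ (G.cycles S)

open Classical in
/-- `𝒞_k(G)`: the connected spanning subgraphs with first Betti number `k`. -/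
noncomputable def connectedSubgraphs (G : OrientedGraph V E) (k : ℕ) : Finset (Finset E) :=
  Finset.univ.filter fun S => G.IsConnected S ∧ G.bettiOne S = k

open Classical in
/-- `ℱ_k(G)`: the acyclic spanning subgraphs (spanning forests) with `k` connected components. -/
noncomputable def spanningForests (G : OrientedGraph V E) (k : ℕ) : Finset (Finset E) :=
  Finset.univ.filter fun S => G.cycles S = ⊥ ∧ G.numComponents S = k

/-- The pairing `(α, a)` between the `k`-th exterior powers of `1`-cochains and `1`-chains, with
`(α₁ ∧ ⋯ ∧ α_k, a₁ ∧ ⋯ ∧ a_k) = det ((α_i, a_j))` and `(α, a) = ∑ e, α e * a e` for `k = 1`. -/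
noncomputable def extPairing (E R : Type*) [Fintype E] [DecidableEq E] [CommRing R] (k : ℕ) :
    ⋀[R]^k (E → R) →ₗ[R] ⋀[R]^k (E → R) →ₗ[R] R :=
  exteriorPower.pairingDual R (E → R) k ∘ₗ
    exteriorPower.map k (dotProductEquiv R E).toLinearMap

theorem extPairing_ιMulti (R : Type*) [CommRing R] (k : ℕ) (α a : Fin k → E → R) :
    extPairing E R k (exteriorPower.ιMulti R k α) (exteriorPower.ιMulti R k a) =
      Matrix.det (Matrix.of fun i j => ∑ e, α i e * a j e) := by
  rw [← Matrix.det_transpose]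
  simp only [extPairing, LinearMap.comp_apply, exteriorPower.map_apply_ιMulti,
    exteriorPower.pairingDual_ιMulti_ιMulti]
  rfl

/-- The image in `⋀^k (E → 𝕜)` of the exterior product of the elements of an integral basis of a
submodule `M` of `ℤ^E` of rank `k`. The choice of the basis only affects the sign, see
`integralVolume_eq_or_neg`. (It is set to `0` if the rank of `M` is not `k`; this case never
occurs in `polyC` and, for connected graphs, in `polyA`.) -/
noncomputable def integralVolume (𝕜 : Type*) [RCLike 𝕜] (k : ℕ) (M : Submodule ℤ (E → ℤ)) :
    ⋀[𝕜]^k (E → 𝕜) :=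
  open Classical in
  if h : Module.finrank ℤ M = k then
    exteriorPower.ιMulti 𝕜 k fun i e => ((Module.finBasisOfFinrankEq ℤ M h i : E → ℤ) e : 𝕜)
  else 0

theorem integralVolume_eq_or_neg (𝕜 : Type*) [RCLike 𝕜] {k : ℕ} {M : Submodule ℤ (E → ℤ)}
    (b : Module.Basis (Fin k) ℤ M) :
    integralVolume 𝕜 k M = exteriorPower.ιMulti 𝕜 k (fun i e => ((b i : E → ℤ) e : 𝕜)) ∨
      integralVolume 𝕜 k M = -exteriorPower.ιMulti 𝕜 k (fun i e => ((b i : E → ℤ) e : 𝕜)) := by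
  have h : Module.finrank ℤ M = k := by simpa using Module.finrank_eq_card_basis b
  let cast : M →ₗ[ℤ] (E → 𝕜) :=
    { toFun := fun m e => ((m : E → ℤ) e : 𝕜)
      map_add' := fun _ _ => by ext; simp
      map_smul' := fun _ _ => by ext; simp }
  let f : M [⋀^Fin k]→ₗ[ℤ] ⋀[𝕜]^k (E → 𝕜) :=
    { toMultilinearMap :=
        ((exteriorPower.ιMulti 𝕜 k).toMultilinearMap.restrictScalars ℤ).compLinearMap
          fun _ => cast
      map_eq_zero_of_eq' := fun v i j hv hij =>
        (exteriorPower.ιMulti 𝕜 k).map_eq_zero_of_eq _ (congrArg cast hv) hij }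
  have key : f = (LinearMap.toSpanSingleton ℤ _ (f fun i => b i)).compAlternatingMap b.det := by
    refine Module.Basis.ext_alternating b fun v hv => ?_
    let σ : Equiv.Perm (Fin k) := Equiv.ofBijective v (Finite.injective_iff_bijective.mp hv)
    have h1 : f (fun i => b (v i)) = Equiv.Perm.sign σ • f fun i => b i := f.map_perm b σ
    have h2 : b.det (fun i => b (v i)) = Equiv.Perm.sign σ • b.det (fun i => b i) :=
      b.det.map_perm b σ
    rw [h1, LinearMap.compAlternatingMap_apply, h2, b.det_self]
    simp [LinearMap.toSpanSingleton_apply, Units.smul_def]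
  have hv : integralVolume 𝕜 k M =
      b.det (Module.finBasisOfFinrankEq ℤ M h) • f fun i => b i := by
    rw [integralVolume, dif_pos h]
    exact DFunLike.congr_fun key fun i => Module.finBasisOfFinrankEq ℤ M h i
  rcases Int.isUnit_iff.mp (b.isUnit_det (Module.finBasisOfFinrankEq ℤ M h)) with h1 | h1
  · left; rw [hv, h1, one_smul]; rfl
  · right; rw [hv, h1, neg_smul, one_smul]; rfl

/-- The polynomial `C^{(k)}_G(ϑ, x) = ∑_{K ∈ 𝒞_k(G)} |(ϑ, z_K)|² x^K`, where `ϑ` is an element of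
the `k`-th exterior power of the `1`-forms, and `z_K` is the exterior product of the elements of an
integral basis of `Z₁(K, ℤ)`. -/
noncomputable def polyC {𝕜 : Type*} [RCLike 𝕜] (G : OrientedGraph V E) (k : ℕ)
    (ϑ : ⋀[𝕜]^k (E → 𝕜)) : MvPolynomial E ℝ :=
  ∑ K ∈ G.connectedSubgraphs k,
    MvPolynomial.C (‖extPairing E 𝕜 k ϑ (integralVolume 𝕜 k (G.cycles K))‖ ^ 2) *
      ∏ e ∈ K, MvPolynomial.X e

/-- The polynomial `A^{(k)}_G(φ, x) = ∑_{F ∈ ℱ_{k+1}(G)} |(φ, b_F)|² x^F`, where `φ` is an element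
of the `k`-th exterior power of the `1`-chains, and `b_F` is the exterior product of the elements
of an integral basis of `B¹(G/F, ℤ)`. -/
noncomputable def polyA {𝕜 : Type*} [RCLike 𝕜] (G : OrientedGraph V E) (k : ℕ)
    (φ : ⋀[𝕜]^k (E → 𝕜)) : MvPolynomial E ℝ :=
  ∑ F ∈ G.spanningForests (k + 1),
    MvPolynomial.C (‖extPairing E 𝕜 k (integralVolume 𝕜 k (G.contractedCuts F)) φ‖ ^ 2) *
      ∏ e ∈ F, MvPolynomial.X e

end OrientedGraph

/-- A real polynomial is real stable if it does not vanish when all its variables have positive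
imaginary part. -/
def RealStable {E : Type*} (p : MvPolynomial E ℝ) : Prop :=
  ∀ z : E → ℂ, (∀ e, 0 < (z e).im) → MvPolynomial.aeval z p ≠ 0

/-! Up to a nonzero real factor, both polynomials have the form det(N diag(x) N*), where the columns
of N are indexed by the edges. If N has full row rank, such a determinant cannot vanish when all z_e
have positive imaginary part: for v in the kernel and w = N* v one gets ∑ z_e |w_e|² = 0, whose
imaginary part forces w = 0, hence v = 0. By Cauchy–Binet the coefficient of x^S is |det N_S|², with
N_S the square submatrix on the columns S (`realStable_of_minors`). It remains to match coefficients
with minors and to prove full rank.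

For C, fix a vertex v₀ and let the rows of N be the coboundaries of the vertices other than v₀,
followed by the θ_i. If S is connected with Betti number k, a unimodular change of basis of ℤ^S
adapted to the boundary map makes N_S block triangular, with blocks 1 and (θ_i(z_j))
(`norm_det_formMatrix_of_isConnected`). If S is disconnected, the indicator function of the vertices
outside the component of v₀ gives a relation between the rows.

For A, drop the coordinate v₀ from the boundary map, extend the ∂φ_i to a basis P of 𝕜^(V∖v₀), and
let N be the matrix of ∂ modulo the span of the ∂φ_i. A cycle in F is a relation between the columns
of N_F. For a forest F, a unimodular basis of vertex functions, made of primitives of the cuts and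
of functions whose coboundaries are dual to the edges of F, gives |(φ, b_F)| = |det P| |det N_F|
(`norm_det_quotientBoundaryMatrix`).

Full rank follows from one nonzero coefficient, or from transversality to im d or ker ∂ since the
graph is connected. -/

set_option linter.unusedSectionVars false

/-! ### Cauchy–Binet and stability of weighted Gram determinants -/

open Matrix in
/-- The **Cauchy–Binet formula**. -/
theorem Matrix.det_mul_eq_sum_powersetCard {R ι E : Type*} [CommRing R] [Fintype ι] [DecidableEq ι]
    [Fintype E] [DecidableEq E] (A : Matrix ι E R) (B : Matrix E ι R) (c : Finset E → R)
    (hc : ∀ (S : Finset E) (e : ι ≃ S), c S =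
      (A.submatrix id fun i => (e i : E)).det * (B.submatrix (fun i => (e i : E)) id).det) :
    (A * B).det = ∑ S ∈ Finset.univ.powersetCard (Fintype.card ι), c S := by
  have h1 : (A * B).det = ∑ f : ι → E, (A.submatrix id f).det * ∏ i, B (f i) i := by
    simp only [det_apply', mul_apply, Finset.prod_univ_sum, Finset.mul_sum,
      Fintype.piFinset_univ, Finset.sum_mul, submatrix_apply, id, Finset.prod_mul_distrib]
    rw [Finset.sum_comm]
    simp only [mul_assoc]
  have h2 : (A * B).det = ∑ f : ι → E with Function.Injective f,
      (A.submatrix id f).det * ∏ i, B (f i) i := by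
    rw [h1]
    refine (Finset.sum_subset (Finset.filter_subset _ _) fun f _ hf => ?_).symm
    have hf' : ¬ Function.Injective f := by simpa using hf
    rw [Function.Injective] at hf'
    push Not at hf'
    obtain ⟨i, j, hij, hne⟩ := hf'
    rw [det_zero_of_column_eq hne fun l => by simp [hij], zero_mul]
  rw [h2, ← Finset.sum_fiberwise_of_maps_to (g := fun f => Finset.univ.image f)
    (t := Finset.univ.powersetCard (Fintype.card ι))]
  · refine Finset.sum_congr rfl fun S hS => ?_
    have hS' : Fintype.card ι = Fintype.card S := by
      rw [Fintype.card_coe, (Finset.mem_powersetCard.mp hS).2]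
    let e : ι ≃ S := Fintype.equivOfCardEq hS'
    -- Reordering the columns of the first factor produces exactly the signs of the Leibniz
    -- expansion of the second minor.
    have h3 : ∀ σ : Equiv.Perm ι, (A.submatrix id fun i => (e (σ i) : E)).det =
        Equiv.Perm.sign σ * (A.submatrix id fun i => (e i : E)).det := fun σ =>
      det_permute' σ (A.submatrix id fun i => (e i : E))
    rw [hc S e, det_apply' (B.submatrix _ _), Finset.mul_sum]
    symm
    refine Finset.sum_bij (fun σ _ i => (e (σ i) : E)) ?_ ?_ ?_ ?_
    · intro σ _
      simp only [Finset.mem_filter, Finset.mem_univ, true_and]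
      refine ⟨Subtype.val_injective.comp (e.injective.comp σ.injective), ?_⟩
      ext x
      simp only [Finset.mem_image, Finset.mem_univ, true_and]
      constructor
      · rintro ⟨i, rfl⟩; exact (e (σ i)).2
      · intro hx; exact ⟨σ.symm (e.symm ⟨x, hx⟩), by simp⟩
    · intro σ _ τ _ h
      ext i
      exact e.injective (Subtype.ext (congrFun h i))
    · intro f hf
      simp only [Finset.mem_filter, Finset.mem_univ, true_and] at hf
      obtain ⟨hinj, himg⟩ := hf
      have hmem : ∀ i, f i ∈ S := fun i => by
        rw [← himg]; exact Finset.mem_image_of_mem _ (Finset.mem_univ i)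
      refine ⟨Equiv.ofBijective (fun i => e.symm ⟨f i, hmem i⟩) ?_, Finset.mem_univ _, ?_⟩
      · rw [← Finite.injective_iff_bijective]
        intro i j hij
        exact hinj (congrArg Subtype.val (e.symm.injective hij))
      · ext i; simp
    · intro σ _
      rw [h3]
      simp only [submatrix_apply, id]
      ring
  · intro f hf
    simp only [Finset.mem_filter, Finset.mem_univ, true_and] at hf
    simp [Finset.mem_powersetCard, Finset.card_image_of_injective _ hf]

/-- Every `RCLike` field embeds isometrically into `ℂ`. -/
theorem RCLike.exists_ringHom_complex (𝕜 : Type*) [RCLike 𝕜] :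
    ∃ σ : 𝕜 →+* ℂ, ∀ z, ‖σ z‖ = ‖z‖ := by
  rcases RCLike.I_eq_zero_or_im_I_eq_one (K := 𝕜) with h | h
  · refine ⟨Complex.ofRealHom.comp (RCLike.realRingEquiv h).toRingHom, fun z => ?_⟩
    have := (RCLike.realLinearIsometryEquiv h).norm_map z
    simpa using this
  · refine ⟨(RCLike.complexRingEquiv h).toRingHom, fun z => ?_⟩
    exact (RCLike.complexLinearIsometryEquiv h).norm_map z

open Matrix in
/-- A weighted Gram matrix whose weights have positive imaginary parts is nonsingular, if the
matrix it is built from has a right inverse. -/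
theorem Matrix.det_mul_diagonal_mul_conjTranspose_ne_zero {ι E : Type*} [Fintype ι] [DecidableEq ι]
    [Fintype E] [DecidableEq E] (N : Matrix ι E ℂ) (R : Matrix E ι ℂ) (hR : N * R = 1)
    (z : E → ℂ) (hz : ∀ e, 0 < (z e).im) : (N * (diagonal z * Nᴴ)).det ≠ 0 := by
  intro h0
  obtain ⟨v, hv, h⟩ := exists_mulVec_eq_zero_iff.mpr h0
  apply hv
  set w := Nᴴ *ᵥ v with hw
  have h1 : star w ⬝ᵥ (diagonal z *ᵥ w) = 0 := by
    have : star v ⬝ᵥ ((N * (diagonal z * Nᴴ)) *ᵥ v) = 0 := by rw [h, dotProduct_zero]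
    rw [← this, hw, star_mulVec, conjTranspose_conjTranspose, ← mulVec_mulVec, ← mulVec_mulVec,
      dotProduct_mulVec (star v)]
  -- Imaginary part of the quadratic form ∑ z_e |w_e|².
  have h2 : ∑ e, (z e).im * Complex.normSq (w e) = 0 := by
    have := congrArg Complex.im h1
    simp only [dotProduct, mulVec_diagonal, Pi.star_apply, Complex.im_sum, Complex.zero_im] at this
    rw [← this]
    refine Finset.sum_congr rfl fun e _ => ?_
    rw [show star (w e) * (z e * w e) = z e * (w e * (starRingEnd ℂ) (w e)) by
      simp only [starRingEnd_apply]; ring, Complex.mul_conj]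
    simp
  have h3 : w = 0 := by
    ext e
    have := (Finset.sum_eq_zero_iff_of_nonneg fun e _ =>
      mul_nonneg (hz e).le (Complex.normSq_nonneg (w e))).mp h2 e (Finset.mem_univ e)
    simpa [(hz e).ne'] using this
  have h4 : Rᴴ * Nᴴ = 1 := by rw [← conjTranspose_mul, hR, conjTranspose_one]
  rw [← one_mulVec v, ← h4, ← mulVec_mulVec, ← hw, h3, mulVec_zero]

/-- Full row rank makes `mulVec` surjective. A right inverse, unlike independence, is carried along
the embedding of 𝕜 into ℂ with no further argument. -/
theorem Matrix.exists_right_inverse_of_linearIndependent {𝕜 ι E : Type*} [Field 𝕜] [Fintype ι]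
    [DecidableEq ι] [Fintype E] (N : Matrix ι E 𝕜) (hN : LinearIndependent 𝕜 N.row) :
    ∃ R : Matrix E ι 𝕜, N * R = 1 := by
  classical
  rw [← Matrix.mulVec_surjective_iff_exists_right_inverse]
  have h := hN.rank_matrix
  have : LinearMap.range N.mulVecLin = ⊤ := by
    apply Submodule.eq_top_of_finrank_eq
    rw [Module.finrank_fintype_fun_eq_card, ← h, Matrix.rank]
  exact LinearMap.range_eq_top.mp this

/-- A sum of monomials weighted by the squared norms of the maximal minors of a matrix of full row
rank is real stable. -/
theorem realStable_of_minors {𝕜 ι E : Type*} [RCLike 𝕜] [Fintype ι] [DecidableEq ι] [Fintype E]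
    [DecidableEq E] (N : Matrix ι E 𝕜) (hN : LinearIndependent 𝕜 N.row) {a : ℝ} (ha : a ≠ 0)
    (c : Finset E → ℝ)
    (hc : ∀ (S : Finset E) (e : ι ≃ S),
      c S = a * ‖(N.submatrix id fun i => (e i : E)).det‖ ^ 2) :
    RealStable (∑ S ∈ Finset.univ.powersetCard (Fintype.card ι),
      MvPolynomial.C (c S) * ∏ e ∈ S, MvPolynomial.X e) := by
  intro z hz
  obtain ⟨R, hR⟩ := N.exists_right_inverse_of_linearIndependent hN
  obtain ⟨σ, hσ⟩ := RCLike.exists_ringHom_complex 𝕜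
  have hR' : N.map σ * R.map σ = 1 := by
    rw [← Matrix.map_mul, hR, Matrix.map_one _ (map_zero σ) (map_one σ)]
  have h0 := (N.map σ).det_mul_diagonal_mul_conjTranspose_ne_zero _ hR' z hz
  -- The determinant is `a⁻¹` times the value of the polynomial at `z`.
  rw [Matrix.det_mul_eq_sum_powersetCard _ _ fun S => (a : ℂ)⁻¹ * c S * ∏ e ∈ S, z e] at h0
  · simp only [mul_assoc] at h0
    rw [← Finset.mul_sum] at h0
    simpa using right_ne_zero_of_mul h0
  · intro S e
    have h1 : ((N.map σ).submatrix id fun i => (e i : E)).det =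
        σ (N.submatrix id fun i => (e i : E)).det := (σ.map_det _).symm
    have h2 : ((Matrix.diagonal z * (N.map σ).conjTranspose).submatrix
        (fun i => (e i : E)) id).det =
        (∏ e ∈ S, z e) * star (((N.map σ).submatrix id fun i => (e i : E)).det) := by
      rw [← Matrix.det_conjTranspose, ← Finset.prod_coe_sort S z,
        ← Equiv.prod_comp e fun s : S => z s, ← Matrix.det_mul_column]
      congr 1
      ext i j
      simp [Matrix.diagonal_mul]
    rw [h2, h1, hc S e, ← hσ]
    have h3 := Complex.mul_conj' (σ (N.submatrix id fun i => (e i : E)).det)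
    rw [starRingEnd_apply] at h3
    rw [mul_left_comm, h3]
    have : (a : ℂ) ≠ 0 := by exact_mod_cast ha
    push_cast
    field_simp

/-! ### Adapted integral bases -/

/-- A basis of the kernel of a surjective map and a basis of its target combine to a basis of its
source. -/
theorem Module.Basis.exists_sum_of_surjective {R M P ι κ : Type*} [CommRing R] [AddCommGroup M]
    [Module R M] [AddCommGroup P] [Module R P] [Finite ι] (f : M →ₗ[R] P)
    (hf : Function.Surjective f) (bP : Module.Basis ι R P)
    (bK : Module.Basis κ R (LinearMap.ker f)) :
    ∃ b : Module.Basis (ι ⊕ κ) R M,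
      (∀ i, f (b (.inl i)) = bP i) ∧ ∀ j, b (.inr j) = (bK j : M) := by
  choose s hs using hf
  -- Since `P` is free, `f` has a linear section, so `M` splits as `P × ker f`.
  let g : P →ₗ[R] M := bP.constr R fun i => s (bP i)
  have hg : ∀ p, f (g p) = p := fun p =>
    LinearMap.congr_fun (bP.ext (f₁ := f ∘ₗ g) (f₂ := LinearMap.id) fun i => by
      simp [g, hs]) p
  let φ : (P × LinearMap.ker f) →ₗ[R] M := g.coprod (LinearMap.ker f).subtype
  have hφ : Function.Bijective φ := by
    constructor
    · rw [injective_iff_map_eq_zero]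
      rintro ⟨p, q⟩ h
      have h' : g p + q = 0 := h
      have hp : p = 0 := by
        have := congrArg f h'
        simpa [hg] using this
      subst hp
      simpa using h'
    · intro m
      refine ⟨(f m, ⟨m - g (f m), by simp [hg]⟩), by simp [φ]⟩
  refine ⟨(bP.prod bK).map (LinearEquiv.ofBijective φ hφ), fun i => ?_, fun j => ?_⟩
  · simp [φ, hg]
  · simp [φ]

/-- The coordinate matrix of an integral basis has determinant of absolute value `1`. -/
theorem Module.Basis.norm_det_intCast {𝕜 ι κ : Type*} [RCLike 𝕜] [Fintype ι] [DecidableEq ι]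
    [Fintype κ] (b : Module.Basis ι ℤ (κ → ℤ)) (e : ι ≃ κ) :
    ‖(Matrix.of fun i j => ((b j (e i) : ℤ) : 𝕜)).det‖ = 1 := by
  have h := ((Pi.basisFun ℤ κ).reindex e.symm).isUnit_det b
  have h1 : (Matrix.of fun i j => ((b j (e i) : ℤ) : 𝕜)).det =
      ((((Pi.basisFun ℤ κ).reindex e.symm).det b : ℤ) : 𝕜) := by
    rw [Module.Basis.det_apply, ← eq_intCast (Int.castRingHom 𝕜), RingHom.map_det]
    congr 1
  rw [h1]
  rcases Int.isUnit_iff.mp h with h | h <;> simp [h]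

theorem Fintype.sum_mul_extend_val {α R : Type*} [Fintype α] [CommRing R] {p : α → Prop}
    [Fintype {a // p a}] (g : α → R) (c : {a // p a} → ℤ) :
    ∑ a, g a * ((Function.extend Subtype.val c 0 a : ℤ) : R) =
      ∑ s : {a // p a}, g s * (c s : R) := by
  classical
  rw [← Finset.sum_subset (Finset.subset_univ (Finset.univ.map (Function.Embedding.subtype p)))]
  · simp
  · intro a _ ha
    rw [Function.extend_apply', Pi.zero_apply, Int.cast_zero, mul_zero]
    rintro ⟨s, rfl⟩
    simp at ha

theorem LinearMap.finrank_eq_add_finrank_ker_of_surjective {M P : Type*} [AddCommGroup M]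
    [AddCommGroup P] [Module.Finite ℤ M] (f : M →ₗ[ℤ] P) (hf : Function.Surjective f) :
    Module.finrank ℤ P + Module.finrank ℤ (LinearMap.ker f) = Module.finrank ℤ M := by
  rw [← (f.quotKerEquivOfSurjective hf).finrank_eq, Submodule.finrank_quotient_add_finrank]

/-! ### Boundary, coboundary and connectedness -/

namespace OrientedGraph

variable {V E : Type*} [Fintype V] [Fintype E] [DecidableEq V] [DecidableEq E]
  (G : OrientedGraph V E)

theorem boundary_single (R : Type*) [CommRing R] (e : E) :
    G.boundary R (Pi.single e 1) = Pi.single (G.tgt e) 1 - Pi.single (G.src e) 1 := by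
  change ∑ e', (Pi.single e 1 : E → R) e' • _ = _
  rw [Finset.sum_eq_single e] <;> simp +contextual

theorem coboundary_apply {R : Type*} [CommRing R] (f : V → R) (e : E) :
    G.coboundary R f e = f (G.tgt e) - f (G.src e) := rfl

/-- The boundary and the coboundary operators are adjoint to each other. -/
theorem sum_mul_boundary {R : Type*} [CommRing R] (f : V → R) (c : E → R) :
    ∑ v, f v * G.boundary R c v = ∑ e, G.coboundary R f e * c e := by
  have h : ∀ v, G.boundary R c v =
      ∑ e, c e * ((Pi.single (G.tgt e) 1 : V → R) v - (Pi.single (G.src e) 1 : V → R) v) := by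
    intro v
    simp [boundary, Finset.sum_apply]
  simp only [h, Finset.mul_sum]
  rw [Finset.sum_comm]
  refine Finset.sum_congr rfl fun e _ => ?_
  simp only [coboundary_apply, Pi.single_apply, mul_sub, mul_ite, mul_one, mul_zero,
    Finset.sum_sub_distrib, Finset.sum_ite_eq', Finset.mem_univ, if_true]
  ring

theorem sum_boundary {R : Type*} [CommRing R] (c : E → R) : ∑ v, G.boundary R c v = 0 := by
  have := G.sum_mul_boundary 1 c
  simpa [coboundary_apply] using this

theorem boundary_intCast {R : Type*} [CommRing R] (c : E → ℤ) (v : V) :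
    G.boundary R (fun e => (c e : R)) v = (G.boundary ℤ c v : R) := by
  simp [boundary, Finset.sum_apply, Pi.single_apply]

theorem coboundary_intCast {R : Type*} [CommRing R] (f : V → ℤ) (e : E) :
    G.coboundary R (fun v => (f v : R)) e = (G.coboundary ℤ f e : R) := by
  simp [coboundary_apply]

theorem eq_of_coboundary_eq_zero {R : Type*} [CommRing R] {S : Finset E} {f : V → R}
    (hf : ∀ e ∈ S, G.coboundary R f e = 0) {u v : V} (huv : G.componentSetoid S u v) :
    f u = f v := by
  have huv' : Relation.EqvGen _ u v := huv
  induction huv' with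
  | rel u v h =>
    obtain ⟨e, he, rfl, rfl⟩ := h
    exact (sub_eq_zero.mp (hf e he)).symm
  | refl => rfl
  | symm u v _ ih => exact (ih ‹_›).symm
  | trans u v w _ _ ih1 ih2 => exact (ih1 ‹_›).trans (ih2 ‹_›)

theorem componentSetoid_of_mem {S : Finset E} {e : E} (he : e ∈ S) :
    G.componentSetoid S (G.src e) (G.tgt e) :=
  Relation.EqvGen.rel _ _ ⟨e, he, rfl, rfl⟩

/-- Two vertices in the same component are joined by an integral chain. -/
theorem exists_boundary_eq {S : Finset E} {u v : V} (huv : G.componentSetoid S u v) :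
    ∃ c : E → ℤ, (∀ e ∉ S, c e = 0) ∧ G.boundary ℤ c = Pi.single v 1 - Pi.single u 1 := by
  have huv' : Relation.EqvGen _ u v := huv
  induction huv' with
  | rel u v h =>
    obtain ⟨e, he, rfl, rfl⟩ := h
    refine ⟨Pi.single e 1, fun e' he' => ?_, G.boundary_single ℤ e⟩
    rw [Pi.single_eq_of_ne]
    rintro rfl
    exact he' he
  | refl => exact ⟨0, fun _ _ => rfl, by simp⟩
  | symm u v _ ih =>
    obtain ⟨c, h1, h2⟩ := ih ‹_›
    exact ⟨-c, fun e he => by simp [h1 e he], by rw [map_neg, h2, neg_sub]⟩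
  | trans u v w _ _ ih1 ih2 =>
    obtain ⟨c, h1, h2⟩ := ih1 ‹_›
    obtain ⟨d, h3, h4⟩ := ih2 ‹_›
    exact ⟨c + d, fun e he => by simp [h1 e he, h3 e he], by rw [map_add, h2, h4]; abel⟩

theorem mem_cycles {S : Finset E} {c : E → ℤ} :
    c ∈ G.cycles S ↔ G.boundary ℤ c = 0 ∧ ∀ e ∉ S, c e = 0 := by
  simp [cycles]

/-! ### Adapted bases for connected subgraphs -/

/-- The boundary operator on the chains of the spanning subgraph `(V, S)`, with the coordinate at
the vertex `v₀` left out. -/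
noncomputable def reducedBoundary (v₀ : V) (S : Finset E) :
    (S → ℤ) →ₗ[ℤ] ({v : V // v ≠ v₀} → ℤ) :=
  LinearMap.funLeft ℤ ℤ Subtype.val ∘ₗ G.boundary ℤ ∘ₗ
    Function.ExtendByZero.linearMap ℤ (Subtype.val : S → E)

theorem reducedBoundary_apply (v₀ : V) (S : Finset E) (c : S → ℤ) (v : {v : V // v ≠ v₀}) :
    G.reducedBoundary v₀ S c v = G.boundary ℤ (Function.extend Subtype.val c 0) v := rfl

/-- The coordinates of a boundary sum to zero, so the one at `v₀` is redundant. -/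
theorem boundary_eq_zero_of_forall_ne {R : Type*} [CommRing R] {v₀ : V} {c : E → R}
    (h : ∀ v, v ≠ v₀ → G.boundary R c v = 0) : G.boundary R c = 0 := by
  ext v
  by_cases hv : v = v₀
  · have := G.sum_boundary c
    rw [Finset.sum_eq_single v₀ (fun w _ hw => h w hw) (by simp)] at this
    rw [hv, this, Pi.zero_apply]
  · exact h v hv

theorem extend_restrict_of_forall_notMem {α R : Type*} [Zero R] {p : α → Prop} {c : α → R}
    (hc : ∀ a, ¬ p a → c a = 0) :
    Function.extend Subtype.val (fun s : {a // p a} => c s) 0 = c := by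
  ext a
  by_cases ha : p a
  · exact Subtype.val_injective.extend_apply (fun s : {a // p a} => c s) 0 ⟨a, ha⟩
  · rw [Function.extend_apply', Pi.zero_apply, hc a ha]
    rintro ⟨s, rfl⟩
    exact ha s.2

/-- A chain in `S` joining `v₀` to `v` has boundary v - v₀, which becomes the basis vector at `v`
once the coordinate `v₀` is dropped. -/
theorem reducedBoundary_surjective (v₀ : V) {S : Finset E} (hS : G.IsConnected S) :
    Function.Surjective (G.reducedBoundary v₀ S) := by
  rw [← LinearMap.range_eq_top, eq_top_iff, ← (Pi.basisFun ℤ _).span_eq, Submodule.span_le]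
  rintro _ ⟨v, rfl⟩
  obtain ⟨c, hc, h⟩ := G.exists_boundary_eq (hS.2 v₀ v)
  refine ⟨fun s => c s, ?_⟩
  ext w
  rw [reducedBoundary_apply, extend_restrict_of_forall_notMem hc, h]
  simp [Pi.single_apply, w.2, Subtype.ext_iff]

/-- The cycles of the spanning subgraph `(V, S)` are the kernel of its reduced boundary
operator. -/
noncomputable def kerReducedBoundaryEquiv (v₀ : V) (S : Finset E) :
    LinearMap.ker (G.reducedBoundary v₀ S) ≃ₗ[ℤ] G.cycles S :=
  LinearEquiv.ofBijective
    ((Function.ExtendByZero.linearMap ℤ (Subtype.val : S → E)).restrict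
      (p := LinearMap.ker (G.reducedBoundary v₀ S)) (q := G.cycles S) (fun c hc => by
        refine G.mem_cycles.mpr ⟨G.boundary_eq_zero_of_forall_ne (v₀ := v₀) fun v hv =>
          congrFun (LinearMap.mem_ker.mp hc) ⟨v, hv⟩, fun e he => ?_⟩
        refine Function.extend_apply' _ _ _ ?_
        rintro ⟨s, rfl⟩
        exact he s.2)) (by
      constructor
      · intro c d h
        ext s
        have := congrFun (congrArg Subtype.val h) (s : E)
        change Function.extend Subtype.val (c : S → ℤ) 0 (s : E) =
          Function.extend Subtype.val (d : S → ℤ) 0 (s : E) at this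
        simpa only [Subtype.val_injective.extend_apply] using this
      · rintro ⟨c, hc⟩
        obtain ⟨h1, h2⟩ := G.mem_cycles.mp hc
        have h3 := extend_restrict_of_forall_notMem h2
        refine ⟨⟨fun s => c s, ?_⟩, Subtype.ext h3⟩
        ext v
        rw [reducedBoundary_apply, h3, h1]
        rfl)

theorem kerReducedBoundaryEquiv_apply (v₀ : V) (S : Finset E)
    (c : LinearMap.ker (G.reducedBoundary v₀ S)) :
    (G.kerReducedBoundaryEquiv v₀ S c : E → ℤ) = Function.extend Subtype.val (c : S → ℤ) 0 := rfl

/-- Rank–nullity for the surjective reduced boundary, whose kernel is the cycle group. -/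
theorem IsConnected.card_eq {G : OrientedGraph V E} {S : Finset E} (hS : G.IsConnected S)
    (v₀ : V) : S.card = Fintype.card {v : V // v ≠ v₀} + G.bettiOne S := by
  have h := LinearMap.finrank_eq_add_finrank_ker_of_surjective _
    (G.reducedBoundary_surjective v₀ hS)
  rw [(G.kerReducedBoundaryEquiv v₀ S).finrank_eq] at h
  simpa [bettiOne] using h.symm

/-- An integral basis of the cycles of a connected spanning subgraph extends to a basis of its
chains, the other members of which are mapped to the standard basis by the reduced boundary
operator. -/
theorem IsConnected.exists_basis {G : OrientedGraph V E} {S : Finset E} (hS : G.IsConnected S)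
    (v₀ : V) {k : ℕ} (hk : G.bettiOne S = k) :
    ∃ (z : Module.Basis (Fin k) ℤ (G.cycles S))
      (b : Module.Basis ({v : V // v ≠ v₀} ⊕ Fin k) ℤ (S → ℤ)),
      (∀ v w : {v : V // v ≠ v₀}, G.boundary ℤ (Function.extend Subtype.val (b (.inl v)) 0) w =
        if v = w then 1 else 0) ∧
      ∀ j, Function.extend Subtype.val (b (.inr j)) 0 = (z j : E → ℤ) := by
  let z := Module.finBasisOfFinrankEq ℤ (G.cycles S) hk
  obtain ⟨b, h1, h2⟩ := Module.Basis.exists_sum_of_surjective (G.reducedBoundary v₀ S)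
    (G.reducedBoundary_surjective v₀ hS) (Pi.basisFun ℤ _)
    (z.map (G.kerReducedBoundaryEquiv v₀ S).symm)
  refine ⟨z, b, fun v w => ?_, fun j => ?_⟩
  · rw [← reducedBoundary_apply, h1]
    simp [Pi.single_apply, eq_comm]
  · rw [h2, ← kerReducedBoundaryEquiv_apply]
    simp

/-! ### Adapted bases for forests -/

/-- In a forest, every function on the edges is the coboundary of a function on the vertices. -/
theorem exists_coboundary_eq {F : Finset E} (hF : G.cycles F = ⊥) (α : F → ℤ) :
    ∃ f : V → ℤ, ∀ e : F, G.coboundary ℤ f e = α e := by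
  classical
  -- Deleting `e` separates its endpoints, since a chain joining them in the rest of `F` would close
  -- up to a nonzero cycle. The indicator of the component of the target then has coboundary 1 on
  -- `e` and 0 on the other edges of `F`.
  have key : ∀ e : F, ∃ f : V → ℤ, ∀ e' : F, G.coboundary ℤ f e' = if e' = e then 1 else 0 := by
    intro e
    let r := G.componentSetoid (F.erase e)
    have hne : ¬ r (G.src e) (G.tgt e) := by
      intro h
      obtain ⟨c, hc, hb⟩ := G.exists_boundary_eq h
      have hmem : Pi.single (e : E) 1 - c ∈ G.cycles F := by
        refine G.mem_cycles.mpr ⟨by rw [map_sub, hb, boundary_single, sub_self], fun e' he' => ?_⟩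
        have h1 : e' ≠ e := fun h => he' (h ▸ e.2)
        simp [h1, hc e' fun h => he' (Finset.mem_of_mem_erase h)]
      rw [hF, Submodule.mem_bot] at hmem
      have := congrFun hmem e
      simp [hc e (Finset.notMem_erase _ _)] at this
    refine ⟨fun v => if r v (G.tgt e) then 1 else 0, fun e' => ?_⟩
    rw [coboundary_apply]
    by_cases h : e' = e
    · subst h
      simp [hne]
    · have h' : r (G.src e') (G.tgt e') := G.componentSetoid_of_mem
        (Finset.mem_erase.mpr ⟨fun h' => h (Subtype.ext h'), e'.2⟩)
      have : r (G.src e') (G.tgt e) ↔ r (G.tgt e') (G.tgt e) :=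
        ⟨fun h => r.trans (r.symm h') h, fun h => r.trans h' h⟩
      simp [h, this]
  choose f hf using key
  refine ⟨∑ e, α e • f e, fun e => ?_⟩
  simp only [map_sum, map_smul, Finset.sum_apply, Pi.smul_apply, hf]
  simp

/-- The coboundary operator into the cochains of the spanning subgraph `(V, F)`, on the functions
that vanish at the vertex `v₀`. -/
noncomputable def reducedCoboundary (v₀ : V) (F : Finset E) :
    ({v : V // v ≠ v₀} → ℤ) →ₗ[ℤ] (F → ℤ) :=
  LinearMap.funLeft ℤ ℤ Subtype.val ∘ₗ G.coboundary ℤ ∘ₗ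
    Function.ExtendByZero.linearMap ℤ (Subtype.val : {v : V // v ≠ v₀} → V)

theorem reducedCoboundary_apply (v₀ : V) (F : Finset E) (f : {v : V // v ≠ v₀} → ℤ) (e : F) :
    G.reducedCoboundary v₀ F f e = G.coboundary ℤ (Function.extend Subtype.val f 0) e := rfl

theorem extend_ne_apply {R : Type*} [Zero R] (v₀ : V) (f : {v : V // v ≠ v₀} → R) :
    Function.extend Subtype.val f 0 v₀ = 0 := by
  refine Function.extend_apply' _ _ _ ?_
  rintro ⟨s, h⟩
  exact s.2 h

/-- Constants have zero coboundary, so any function can be normalised to vanish at `v₀`. -/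
theorem coboundary_extend_sub (v₀ : V) (f : V → ℤ) :
    G.coboundary ℤ (Function.extend Subtype.val (fun v : {v : V // v ≠ v₀} => f v - f v₀) 0) =
      G.coboundary ℤ f := by
  have h : Function.extend Subtype.val (fun v : {v : V // v ≠ v₀} => f v - f v₀) 0 =
      fun v => f v - f v₀ :=
    extend_restrict_of_forall_notMem (p := fun v => v ≠ v₀) (c := fun v => f v - f v₀)
      fun v hv => by simp [not_not.mp hv]
  rw [h]
  ext e
  simp [coboundary_apply]

theorem reducedCoboundary_surjective (v₀ : V) {F : Finset E} (hF : G.cycles F = ⊥) :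
    Function.Surjective (G.reducedCoboundary v₀ F) := by
  intro α
  obtain ⟨f, hf⟩ := G.exists_coboundary_eq hF α
  refine ⟨fun v => f v - f v₀, ?_⟩
  ext e
  rw [reducedCoboundary_apply, coboundary_extend_sub, hf]

theorem mem_locallyConstant {F : Finset E} {f : V → ℤ} :
    f ∈ G.locallyConstant F ↔ ∀ e ∈ F, G.coboundary ℤ f e = 0 :=
  ⟨fun h _ he => sub_eq_zero.mpr (h _ _ (G.componentSetoid_of_mem he)).symm,
    fun h _ _ huv => G.eq_of_coboundary_eq_zero h huv⟩

/-- If `G` is connected, then the integral cuts of `G / F` are the image of the kernel of the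
reduced coboundary operator. -/
noncomputable def kerReducedCoboundaryEquiv (hG : G.IsConnected Finset.univ) (v₀ : V)
    (F : Finset E) : LinearMap.ker (G.reducedCoboundary v₀ F) ≃ₗ[ℤ] G.contractedCuts F :=
  LinearEquiv.ofBijective
    ((G.coboundary ℤ ∘ₗ
        Function.ExtendByZero.linearMap ℤ (Subtype.val : {v : V // v ≠ v₀} → V)).restrict
      (p := LinearMap.ker (G.reducedCoboundary v₀ F)) (q := G.contractedCuts F)
      (fun f hf => Submodule.mem_map_of_mem (G.mem_locallyConstant.mpr fun _ he =>
        congrFun (LinearMap.mem_ker.mp hf) ⟨_, he⟩))) (by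
      constructor
      · rw [injective_iff_map_eq_zero]
        intro f hf
        have h1 : G.coboundary ℤ (Function.extend Subtype.val (f : {v : V // v ≠ v₀} → ℤ) 0) = 0 :=
          congrArg Subtype.val hf
        ext v
        -- As the graph is connected, a function with zero coboundary is constant, and its value at
        -- `v₀` is 0.
        have h2 := G.eq_of_coboundary_eq_zero (fun e _ => congrFun h1 e) (hG.2 v v₀)
        rw [extend_ne_apply, Subtype.val_injective.extend_apply] at h2
        exact h2
      · rintro ⟨_, f, hf, rfl⟩
        have h1 := G.coboundary_extend_sub v₀ f
        refine ⟨⟨fun v => f v - f v₀, ?_⟩, Subtype.ext h1⟩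
        ext e
        rw [reducedCoboundary_apply, h1]
        exact G.mem_locallyConstant.mp hf e e.2)

theorem kerReducedCoboundaryEquiv_apply (hG : G.IsConnected Finset.univ) (v₀ : V) (F : Finset E)
    (f : LinearMap.ker (G.reducedCoboundary v₀ F)) :
    (G.kerReducedCoboundaryEquiv hG v₀ F f : E → ℤ) =
      G.coboundary ℤ (Function.extend Subtype.val (f : {v : V // v ≠ v₀} → ℤ) 0) := rfl

theorem finrank_locallyConstant (F : Finset E) :
    Module.finrank ℤ (G.locallyConstant F) = G.numComponents F := by
  let φ : (Quotient (G.componentSetoid F) → ℤ) →ₗ[ℤ] (V → ℤ) := LinearMap.funLeft ℤ ℤ Quotient.mk''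
  have hinj : Function.Injective φ :=
    LinearMap.funLeft_injective_of_surjective ℤ ℤ _ Quotient.mk''_surjective
  have hrange : LinearMap.range φ = G.locallyConstant F := by
    ext f
    constructor
    · rintro ⟨g, rfl⟩ u v huv
      exact congrArg g (Quotient.sound huv)
    · intro hf
      exact ⟨Quotient.lift f hf, rfl⟩
  have : Fintype (Quotient (G.componentSetoid F)) := Fintype.ofFinite _
  rw [← hrange, LinearMap.finrank_range_of_inj hinj, numComponents, Module.finrank_fintype_fun_eq_card,
    Nat.card_eq_fintype_card]

/-- Rank–nullity for the coboundary restricted to `F`: it is onto for a forest, and its kernel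
consists of the functions constant on components. -/
theorem card_eq_card_add_numComponents {F : Finset E} (hF : G.cycles F = ⊥) :
    Fintype.card V = F.card + G.numComponents F := by
  let f : (V → ℤ) →ₗ[ℤ] (F → ℤ) := LinearMap.funLeft ℤ ℤ Subtype.val ∘ₗ G.coboundary ℤ
  have hf : Function.Surjective f := fun α => by
    obtain ⟨g, hg⟩ := G.exists_coboundary_eq hF α
    exact ⟨g, funext hg⟩
  have hker : LinearMap.ker f = G.locallyConstant F := by
    ext g
    rw [mem_locallyConstant, LinearMap.mem_ker, funext_iff, Subtype.forall]
    rfl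
  have h := LinearMap.finrank_eq_add_finrank_ker_of_surjective f hf
  rw [hker, finrank_locallyConstant] at h
  simpa using h.symm

/-- For a spanning forest `F` of a connected graph, an integral basis of the cuts of `G / F` comes
from a part of a basis of the functions on the vertices, the other members of which are mapped to
the standard basis by the reduced coboundary operator. -/
theorem exists_basis_of_cycles_eq_bot (hG : G.IsConnected Finset.univ) (v₀ : V) {F : Finset E}
    (hF : G.cycles F = ⊥) {k : ℕ} (hk : G.numComponents F = k + 1) :
    ∃ (β : Module.Basis (Fin k) ℤ (G.contractedCuts F))
      (b : Module.Basis (F ⊕ Fin k) ℤ ({v : V // v ≠ v₀} → ℤ)),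
      (∀ i e : F, G.coboundary ℤ (Function.extend Subtype.val (b (.inl i)) 0) e =
        if i = e then 1 else 0) ∧
      ∀ j, G.coboundary ℤ (Function.extend Subtype.val (b (.inr j)) 0) = (β j : E → ℤ) := by
  have hrank : Module.finrank ℤ (G.contractedCuts F) = k := by
    have h := LinearMap.finrank_eq_add_finrank_ker_of_surjective _
      (G.reducedCoboundary_surjective v₀ hF)
    rw [(G.kerReducedCoboundaryEquiv hG v₀ F).finrank_eq, Module.finrank_fintype_fun_eq_card,
      Module.finrank_fintype_fun_eq_card, Fintype.card_coe] at h
    have h1 := G.card_eq_card_add_numComponents hF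
    have h2 : Fintype.card {v : V // v ≠ v₀} = Fintype.card V - 1 := by
      rw [Fintype.card_subtype_compl, Fintype.card_subtype_eq]
    omega
  let β := Module.finBasisOfFinrankEq ℤ (G.contractedCuts F) hrank
  obtain ⟨b, h1, h2⟩ := Module.Basis.exists_sum_of_surjective (G.reducedCoboundary v₀ F)
    (G.reducedCoboundary_surjective v₀ hF) (Pi.basisFun ℤ _)
    (β.map (G.kerReducedCoboundaryEquiv hG v₀ F).symm)
  refine ⟨β, b, fun v w => ?_, fun j => ?_⟩
  · rw [← reducedCoboundary_apply, h1]
    simp [Pi.single_apply, eq_comm]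
  · rw [h2, ← kerReducedCoboundaryEquiv_apply G hG]
    simp

end OrientedGraph
-- Padding with zero coefficients lets the sum run over all edge sets of a given size, as in
-- Cauchy–Binet.
theorem MvPolynomial.sum_C_mul_eq_sum_ite {E : Type*} [DecidableEq E] {A B : Finset (Finset E)}
    (h : A ⊆ B) (g : Finset E → ℝ) :
    ∑ S ∈ A, MvPolynomial.C (g S) * ∏ e ∈ S, (MvPolynomial.X e : MvPolynomial E ℝ) =
      ∑ S ∈ B, MvPolynomial.C (if S ∈ A then g S else 0) * ∏ e ∈ S, MvPolynomial.X e := by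
  rw [← Finset.sum_subset h fun S _ hS => by simp [hS]]
  exact Finset.sum_congr rfl fun S hS => by simp [hS]

namespace OrientedGraph

variable {V E : Type*} [Fintype V] [Fintype E] [DecidableEq V] [DecidableEq E]
  {𝕜 : Type*} [RCLike 𝕜]

/-- The norm removes the sign ambiguity, so any integral basis, in particular an adapted one, may be
used. -/
theorem norm_extPairing_integralVolume_right {k : ℕ} {M : Submodule ℤ (E → ℤ)}
    (b : Module.Basis (Fin k) ℤ M) (θ : Fin k → E → 𝕜) :
    ‖extPairing E 𝕜 k (exteriorPower.ιMulti 𝕜 k θ) (integralVolume 𝕜 k M)‖ =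
      ‖(Matrix.of fun i j => ∑ e, θ i e * (((b j : E → ℤ) e : ℤ) : 𝕜)).det‖ := by
  rw [← extPairing_ιMulti]
  rcases integralVolume_eq_or_neg 𝕜 b with h | h <;> rw [h]
  rw [map_neg, norm_neg]

theorem norm_extPairing_integralVolume_left {k : ℕ} {M : Submodule ℤ (E → ℤ)}
    (b : Module.Basis (Fin k) ℤ M) (φ : Fin k → E → 𝕜) :
    ‖extPairing E 𝕜 k (integralVolume 𝕜 k M) (exteriorPower.ιMulti 𝕜 k φ)‖ =
      ‖(Matrix.of fun i j => ∑ e, (((b i : E → ℤ) e : ℤ) : 𝕜) * φ j e).det‖ := by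
  rw [← extPairing_ιMulti]
  rcases integralVolume_eq_or_neg 𝕜 b with h | h <;> rw [h]
  rw [map_neg, LinearMap.neg_apply, norm_neg]

variable (G : OrientedGraph V E)

theorem mem_connectedSubgraphs {k : ℕ} {S : Finset E} :
    S ∈ G.connectedSubgraphs k ↔ G.IsConnected S ∧ G.bettiOne S = k := by
  simp [connectedSubgraphs]

theorem mem_spanningForests {k : ℕ} {S : Finset E} :
    S ∈ G.spanningForests k ↔ G.cycles S = ⊥ ∧ G.numComponents S = k := by
  simp [spanningForests]

theorem sum_coboundary_single_mul {R : Type*} [CommRing R] (v : V) (c : E → R) :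
    ∑ e, G.coboundary R (Pi.single v 1) e * c e = G.boundary R c v := by
  rw [← sum_mul_boundary]
  simp [Pi.single_apply]

/-! ### Coefficients of C as maximal minors -/

/-- The matrix whose rows are the coboundaries of the vertices other than `v₀`, followed by
given `1`-forms. -/
noncomputable def formMatrix (v₀ : V) {k : ℕ} (θ : Fin k → E → 𝕜) :
    Matrix ({v : V // v ≠ v₀} ⊕ Fin k) E 𝕜 :=
  Matrix.of (Sum.elim (fun v => G.coboundary 𝕜 (Pi.single (v : V) 1)) θ)

/-- Right multiplication by the unimodular matrix of an adapted basis of ℤ^S evaluates the rows on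
that basis. Vertex coboundaries vanish on cycles and give the identity on the remaining members, so
only the block of the θ_i on the cycles contributes. -/
theorem norm_det_formMatrix_of_isConnected (v₀ : V) {k : ℕ} (θ : Fin k → E → 𝕜) {S : Finset E}
    (hS : G.IsConnected S) (hk : G.bettiOne S = k) (ε : {v : V // v ≠ v₀} ⊕ Fin k ≃ S) :
    ‖extPairing E 𝕜 k (exteriorPower.ιMulti 𝕜 k θ) (integralVolume 𝕜 k (G.cycles S))‖ =
      ‖((G.formMatrix v₀ θ).submatrix id fun i => (ε i : E)).det‖ := by
  obtain ⟨z, b, h1, h2⟩ := hS.exists_basis v₀ hk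
  have hU := b.norm_det_intCast (𝕜 := 𝕜) ε
  rw [norm_extPairing_integralVolume_right z, ← mul_one ‖((G.formMatrix v₀ θ).submatrix _ _).det‖,
    ← hU, ← norm_mul, ← Matrix.det_mul]
  have hentry : ∀ r j, (((G.formMatrix v₀ θ).submatrix id fun i => (ε i : E)) *
      Matrix.of fun i j => ((b j (ε i) : ℤ) : 𝕜)) r j =
      ∑ e, G.formMatrix v₀ θ r e * ((Function.extend Subtype.val (b j) 0 e : ℤ) : 𝕜) := by
    intro r j
    rw [Fintype.sum_mul_extend_val, Matrix.mul_apply]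
    exact Equiv.sum_comp ε fun s : S => G.formMatrix v₀ θ r s * ((b j s : ℤ) : 𝕜)
  have hblock : (((G.formMatrix v₀ θ).submatrix id fun i => (ε i : E)) *
      Matrix.of fun i j => ((b j (ε i) : ℤ) : 𝕜)) = Matrix.fromBlocks 1 0
        (Matrix.of fun i j => ∑ e, θ i e *
          ((Function.extend Subtype.val (b (.inl j)) 0 e : ℤ) : 𝕜))
        (Matrix.of fun i j => ∑ e, θ i e * (((z j : E → ℤ) e : ℤ) : 𝕜)) := by
    ext (r | r) (j | j)
    · rw [hentry, Matrix.fromBlocks_apply₁₁, Matrix.one_apply]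
      refine (G.sum_coboundary_single_mul (r : V) _).trans ?_
      rw [boundary_intCast, h1]
      simp [eq_comm]
    · rw [hentry, Matrix.fromBlocks_apply₁₂, Matrix.zero_apply]
      refine (G.sum_coboundary_single_mul (r : V) _).trans ?_
      rw [boundary_intCast, h2, (G.mem_cycles.mp (z j).2).1]
      simp
    · rw [hentry]
      rfl
    · rw [hentry, h2]
      rfl
  rw [hblock, Matrix.det_fromBlocks_zero₁₂, Matrix.det_one, one_mul]

theorem det_formMatrix_of_not_isConnected (v₀ : V) {k : ℕ} (θ : Fin k → E → 𝕜) {S : Finset E}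
    (hS : ¬ G.IsConnected S) (ε : {v : V // v ≠ v₀} ⊕ Fin k ≃ S) :
    ((G.formMatrix v₀ θ).submatrix id fun i => (ε i : E)).det = 0 := by
  classical
  let r := G.componentSetoid S
  obtain ⟨u, hu⟩ : ∃ u, ¬ r u v₀ := by
    by_contra! h
    exact hS ⟨⟨v₀⟩, fun u v => r.trans (h u) (r.symm (h v))⟩
  let f : V → 𝕜 := fun v => if r v v₀ then 0 else 1
  have hu₀ : u ≠ v₀ := by rintro rfl; exact hu (r.refl u)
  rw [← Matrix.exists_vecMul_eq_zero_iff]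
  refine ⟨Sum.elim (fun v => f v) 0, fun h => ?_, ?_⟩
  · have := congrFun h (.inl ⟨u, hu₀⟩)
    simp [f, hu] at this
  · ext i
    -- Because `f` vanishes at `v₀`, its coboundary is a combination of the available vertex rows.
    have h1 : ∑ v : {v : V // v ≠ v₀}, f v • (Pi.single (v : V) 1 : V → 𝕜) = f := by
      ext w
      simp only [Finset.sum_apply, Pi.smul_apply, Pi.single_apply, smul_eq_mul, mul_ite, mul_one,
        mul_zero]
      by_cases hw : w = v₀
      · rw [Finset.sum_eq_zero]
        · simp [f, hw]
        · intro v _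
          rw [if_neg]
          rintro rfl
          exact v.2 hw
      · rw [Finset.sum_eq_single ⟨w, hw⟩] <;> simp +contextual [Subtype.ext_iff, eq_comm]
    have h2 : G.coboundary 𝕜 f (ε i) = 0 := by
      have h3 : r (G.src (ε i)) (G.tgt (ε i)) := G.componentSetoid_of_mem (ε i).2
      have h4 : r (G.src (ε i)) v₀ ↔ r (G.tgt (ε i)) v₀ :=
        ⟨fun h => r.trans (r.symm h3) h, fun h => r.trans h3 h⟩
      simp [coboundary_apply, f, h4]
    rw [← h1] at h2
    simpa [Matrix.vecMul, dotProduct, formMatrix, map_sum] using h2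

theorem card_formMatrix_rows (v₀ : V) {k : ℕ} {S : Finset E} (hS : S ∈ G.connectedSubgraphs k) :
    S.card = Fintype.card ({v : V // v ≠ v₀} ⊕ Fin k) := by
  obtain ⟨h1, h2⟩ := G.mem_connectedSubgraphs.mp hS
  rw [h1.card_eq v₀, h2, Fintype.card_sum, Fintype.card_fin]

/-- Among edge sets of the right size, a connected one automatically has Betti number `k`, so every
minor outside the sum defining C vanishes. -/
theorem realStable_polyC_of_linearIndependent (v₀ : V) {k : ℕ} (θ : Fin k → E → 𝕜)
    (h : LinearIndependent 𝕜 (G.formMatrix v₀ θ).row) :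
    RealStable (G.polyC k (exteriorPower.ιMulti 𝕜 k θ)) := by
  rw [polyC, MvPolynomial.sum_C_mul_eq_sum_ite
    (B := Finset.univ.powersetCard (Fintype.card ({v : V // v ≠ v₀} ⊕ Fin k))) fun S hS =>
      Finset.mem_powersetCard.mpr ⟨Finset.subset_univ S, G.card_formMatrix_rows v₀ hS⟩]
  refine realStable_of_minors _ h one_ne_zero _ fun S ε => ?_
  rw [one_mul]
  split_ifs with hS
  · obtain ⟨h1, h2⟩ := G.mem_connectedSubgraphs.mp hS
    rw [G.norm_det_formMatrix_of_isConnected v₀ θ h1 h2 ε]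
  · rw [G.det_formMatrix_of_not_isConnected v₀ θ _ ε, norm_zero, zero_pow two_ne_zero]
    intro h1
    refine hS (G.mem_connectedSubgraphs.mpr ⟨h1, ?_⟩)
    have h2 := Fintype.card_congr ε
    rw [Fintype.card_coe, h1.card_eq v₀, Fintype.card_sum, Fintype.card_fin] at h2
    omega

/-- A nonzero coefficient is a nonzero maximal minor, which makes the rows independent already on
the columns in `S`. -/
theorem linearIndependent_formMatrix_of_polyC_ne_zero (v₀ : V) {k : ℕ} (θ : Fin k → E → 𝕜)
    (h : G.polyC k (exteriorPower.ιMulti 𝕜 k θ) ≠ 0) :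
    LinearIndependent 𝕜 (G.formMatrix v₀ θ).row := by
  obtain ⟨S, hS, hne⟩ := Finset.exists_ne_zero_of_sum_ne_zero h
  obtain ⟨h1, h2⟩ := G.mem_connectedSubgraphs.mp hS
  let ε : {v : V // v ≠ v₀} ⊕ Fin k ≃ S :=
    Fintype.equivOfCardEq (by rw [Fintype.card_coe, G.card_formMatrix_rows v₀ hS])
  have hdet : ((G.formMatrix v₀ θ).submatrix id fun i => (ε i : E)).det ≠ 0 := by
    intro h0
    rw [G.norm_det_formMatrix_of_isConnected v₀ θ h1 h2 ε, h0] at hne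
    simp at hne
  exact LinearIndependent.of_comp (LinearMap.funLeft 𝕜 𝕜 fun i => (ε i : E))
    (Matrix.linearIndependent_rows_of_det_ne_zero hdet)

/-- On a connected graph only constants have zero coboundary, so the vertex rows other than `v₀` are
independent; they span a subspace of im d, which meets the span of `θ` trivially. -/
theorem linearIndependent_formMatrix (hG : G.IsConnected Finset.univ) (v₀ : V) {k : ℕ}
    (θ : Fin k → E → 𝕜) (hθ : LinearIndependent 𝕜 θ)
    (hd : Disjoint (Submodule.span 𝕜 (Set.range θ)) (LinearMap.range (G.coboundary 𝕜))) :
    LinearIndependent 𝕜 (G.formMatrix v₀ θ).row := by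
  refine LinearIndependent.sum_type (v := fun v : {v : V // v ≠ v₀} =>
    G.coboundary 𝕜 (Pi.single (v : V) 1)) ?_ hθ (hd.symm.mono_left ?_)
  · rw [Fintype.linearIndependent_iff]
    intro g hg v
    have h1 : G.coboundary 𝕜 (∑ w : {v : V // v ≠ v₀}, g w • Pi.single (w : V) 1) = 0 := by
      rw [map_sum, ← hg]
      simp
    have h2 := G.eq_of_coboundary_eq_zero (fun e _ => congrFun h1 e) (hG.2 v v₀)
    rw [Finset.sum_apply, Finset.sum_apply, Finset.sum_eq_single v, Finset.sum_eq_zero] at h2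
    · simpa using h2
    · intro w _
      simp [w.2.symm]
    · intro w _ hw
      have : (v : V) ≠ w := fun h => hw (Subtype.ext h.symm)
      simp [this]
    · simp
  · rw [Submodule.span_le]
    rintro _ ⟨v, rfl⟩
    exact ⟨_, rfl⟩

/-! ### Coefficients of A as maximal minors -/

/-- The boundary operator with coefficients in a field, with the coordinate at the vertex `v₀`
left out. -/
noncomputable def boundaryAway (𝕜 : Type*) [CommRing 𝕜] (v₀ : V) :
    (E → 𝕜) →ₗ[𝕜] ({v : V // v ≠ v₀} → 𝕜) :=
  LinearMap.funLeft 𝕜 𝕜 Subtype.val ∘ₗ G.boundary 𝕜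

theorem ker_boundaryAway (v₀ : V) :
    LinearMap.ker (G.boundaryAway 𝕜 v₀) = LinearMap.ker (G.boundary 𝕜) := by
  ext c
  refine ⟨fun h => G.boundary_eq_zero_of_forall_ne (v₀ := v₀) fun v hv => congrFun h ⟨v, hv⟩,
    fun h => ?_⟩
  rw [LinearMap.mem_ker] at h ⊢
  ext v
  exact congrFun h v

theorem boundaryAway_surjective (hG : G.IsConnected Finset.univ) (v₀ : V) :
    Function.Surjective (G.boundaryAway 𝕜 v₀) := by
  rw [← LinearMap.range_eq_top, eq_top_iff, ← (Pi.basisFun 𝕜 _).span_eq, Submodule.span_le]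
  rintro _ ⟨v, rfl⟩
  obtain ⟨c, -, h⟩ := G.exists_boundary_eq (hG.2 v₀ v)
  refine ⟨fun e => (c e : 𝕜), ?_⟩
  ext w
  refine (G.boundary_intCast c w).trans ?_
  rw [h]
  simp [Pi.single_apply, w.2, Subtype.ext_iff]

theorem sum_mul_boundaryAway (v₀ : V) (f : {v : V // v ≠ v₀} → ℤ) (c : E → 𝕜) :
    ∑ v, (f v : 𝕜) * G.boundaryAway 𝕜 v₀ c v =
      ∑ e, ((G.coboundary ℤ (Function.extend Subtype.val f 0) e : ℤ) : 𝕜) * c e := by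
  have h := Fintype.sum_mul_extend_val (fun v => G.boundary 𝕜 c v) f
  simp only [mul_comm (G.boundary 𝕜 c _)] at h
  rw [sum_mul_boundary] at h
  simp only [coboundary_intCast] at h
  exact h.symm

theorem linearIndependent_boundaryAway_of_polyA_ne_zero (hG : G.IsConnected Finset.univ) (v₀ : V)
    {k : ℕ} (φ : Fin k → E → 𝕜) (h : G.polyA k (exteriorPower.ιMulti 𝕜 k φ) ≠ 0) :
    LinearIndependent 𝕜 fun i => G.boundaryAway 𝕜 v₀ (φ i) := by
  obtain ⟨F, hF, hne⟩ := Finset.exists_ne_zero_of_sum_ne_zero h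
  obtain ⟨h1, h2⟩ := G.mem_spanningForests.mp hF
  obtain ⟨β, b, -, hb⟩ := G.exists_basis_of_cycles_eq_bot hG v₀ h1 h2
  have hdet : (Matrix.of fun i j => ∑ e, (((β i : E → ℤ) e : ℤ) : 𝕜) * φ j e).det ≠ 0 := by
    intro h0
    rw [norm_extPairing_integralVolume_left β, h0] at hne
    simp at hne
  -- Pairing with primitives of the cuts is a linear map which, by adjointness of ∂ and δ, sends the
  -- ∂φ_j to the columns of the nonsingular matrix in `hdet`.
  refine LinearIndependent.of_comp
    (Matrix.mulVecLin (Matrix.of fun i v => ((b (.inr i) v : ℤ) : 𝕜))) ?_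
  convert! Matrix.linearIndependent_cols_of_det_ne_zero hdet using 1
  ext j i
  simp only [← hb]
  exact G.sum_mul_boundaryAway v₀ (b (.inr i)) (φ j)

section Forests

variable {G} {v₀ : V} {k : ℕ} {ι : Type*} [Fintype ι] [DecidableEq ι]
  (P : Module.Basis (Fin k ⊕ ι) 𝕜 ({v : V // v ≠ v₀} → 𝕜))

variable (G) in
/-- The matrix of the boundary operator modulo the span of the first `k` members of a basis. -/
noncomputable def quotientBoundaryMatrix : Matrix ι E 𝕜 :=
  Matrix.of fun j e => P.repr (G.boundaryAway 𝕜 v₀ (Pi.single e 1)) (.inr j)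

theorem sum_quotientBoundaryMatrix_mul (c : E → 𝕜) (j : ι) :
    ∑ e, G.quotientBoundaryMatrix P j e * c e =
      P.repr (G.boundaryAway 𝕜 v₀ c) (.inr j) := by
  let L : (E → 𝕜) →ₗ[𝕜] 𝕜 := P.coord (.inr j) ∘ₗ G.boundaryAway 𝕜 v₀
  have h := LinearMap.pi_apply_eq_sum_univ L c
  change _ = L c
  rw [h]
  refine Finset.sum_congr rfl fun e _ => ?_
  have hs : (fun e' => if e = e' then 1 else 0 : E → 𝕜) = Pi.single e 1 := by
    ext e'
    simp [Pi.single_apply, eq_comm]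
  rw [smul_eq_mul, mul_comm, hs]
  rfl

theorem linearIndependent_quotientBoundaryMatrix (hG : G.IsConnected Finset.univ) :
    LinearIndependent 𝕜 (G.quotientBoundaryMatrix P).row := by
  rw [Fintype.linearIndependent_iff]
  intro g hg j
  -- Evaluating the relation on a chain with boundary `P (.inr j)` isolates `g j`.
  obtain ⟨c, hc⟩ := G.boundaryAway_surjective hG v₀ (P (.inr j))
  have h1 : ∑ i, g i * ∑ e, G.quotientBoundaryMatrix P i e * c e = 0 := by
    simp only [Finset.mul_sum]
    rw [Finset.sum_comm]
    refine Finset.sum_eq_zero fun e _ => ?_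
    have := congrFun hg e
    simp only [Finset.sum_apply, Pi.smul_apply, smul_eq_mul, Pi.zero_apply, Matrix.row_apply] at this
    simp only [← mul_assoc]
    rw [← Finset.sum_mul, this, zero_mul]
  simpa [sum_quotientBoundaryMatrix_mul, hc, Finsupp.single_apply] using h1

/-- The coefficients of a nonzero cycle in `F` give a relation between the columns. -/
theorem det_quotientBoundaryMatrix_of_cycles_ne_bot {F : Finset E} (hF : G.cycles F ≠ ⊥)
    (ε : ι ≃ F) : ((G.quotientBoundaryMatrix P).submatrix id fun i => (ε i : E)).det = 0 := by
  obtain ⟨c, hc, hc0⟩ := Submodule.exists_mem_ne_zero_of_ne_bot hF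
  obtain ⟨h1, h2⟩ := G.mem_cycles.mp hc
  rw [← Matrix.exists_mulVec_eq_zero_iff]
  refine ⟨fun i => (c (ε i) : 𝕜), fun h => hc0 ?_, ?_⟩
  · ext e
    by_cases he : e ∈ F
    · simpa using congrFun h (ε.symm ⟨e, he⟩)
    · exact h2 e he
  · ext j
    have h3 : ∑ i, G.quotientBoundaryMatrix P j (ε i) * (c (ε i) : 𝕜) =
        ∑ e, G.quotientBoundaryMatrix P j e * (c e : 𝕜) := by
      rw [Equiv.sum_comp ε fun s : F => G.quotientBoundaryMatrix P j s * (c s : 𝕜),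
        ← Fintype.sum_mul_extend_val _ fun s : F => c s, extend_restrict_of_forall_notMem h2]
    have h4 : G.boundaryAway 𝕜 v₀ (fun e => (c e : 𝕜)) = 0 := by
      ext v
      refine (G.boundary_intCast c v).trans ?_
      rw [h1]
      simp
    refine h3.trans ?_
    rw [sum_quotientBoundaryMatrix_mul, h4]
    simp

theorem norm_det_quotientBoundaryMatrix (hG : G.IsConnected Finset.univ) {φ : Fin k → E → 𝕜}
    (hP : ∀ i, P (.inl i) = G.boundaryAway 𝕜 v₀ (φ i)) (ε₀ : Fin k ⊕ ι ≃ {v : V // v ≠ v₀})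
    {F : Finset E} (hF : G.cycles F = ⊥) (hk : G.numComponents F = k + 1) (ε : ι ≃ F) :
    ‖extPairing E 𝕜 k (integralVolume 𝕜 k (G.contractedCuts F)) (exteriorPower.ιMulti 𝕜 k φ)‖ =
      ‖(Matrix.of fun l i => P i (ε₀ l)).det‖ *
        ‖((G.quotientBoundaryMatrix P).submatrix id fun i => (ε i : E)).det‖ := by
  obtain ⟨β, b, h1, h2⟩ := G.exists_basis_of_cycles_eq_bot hG v₀ hF hk
  -- The given chains followed by the edges of `F`. In the basis `P` the boundaries of the first `k`
  -- are unit vectors, so the coordinate matrix is block triangular with the quotient minor as its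
  -- only nontrivial block.
  let γ : Fin k ⊕ ι → E → 𝕜 := Sum.elim φ fun i => Pi.single (ε i : E) 1
  have hN : (Matrix.of fun i j => P.repr (G.boundaryAway 𝕜 v₀ (γ j)) i).det =
      ((G.quotientBoundaryMatrix P).submatrix id fun i => (ε i : E)).det := by
    rw [← one_mul (Matrix.det (Matrix.submatrix _ _ _)), ← Matrix.det_one (n := Fin k),
      ← Matrix.det_fromBlocks_zero₂₁ _
        (Matrix.of fun i j => P.repr (G.boundaryAway 𝕜 v₀ (γ (.inr j))) (.inl i))]
    congr 1
    ext (i | i) (j | j)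
    · simp [γ, ← hP, Finsupp.single_apply, Matrix.one_apply, eq_comm]
    · simp
    · simp [γ, ← hP]
    · rfl
  -- Primitives of the cuts come first, to match the order of `γ`.
  let b' := b.reindex ((Equiv.sumComm F (Fin k)).trans (Equiv.sumCongr (Equiv.refl _) ε.symm))
  have hb1 : ∀ j, b' (.inl j) = b (.inr j) := fun j => by simp [b']
  have hb2 : ∀ j, b' (.inr j) = b (.inl (ε j)) := fun j => by simp [b']
  have hU := b'.norm_det_intCast (𝕜 := 𝕜) ε₀
  have hβ : ∀ j, ∀ e ∈ F, (β j : E → ℤ) e = 0 := by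
    intro j e he
    obtain ⟨f, hf, h⟩ := (β j).2
    rw [← h]
    exact G.mem_locallyConstant.mp hf e he
  rw [norm_extPairing_integralVolume_left β, ← hN, ← norm_mul, ← Matrix.det_mul, ← one_mul ‖_‖,
    ← one_mul ‖(_ * _ : Matrix _ _ 𝕜).det‖]
  -- Insert the unimodular determinant of `b'`: its transpose times the boundaries of `γ` is, by
  -- adjointness, the pairing of the coboundaries of `b'` with `γ`. This is block triangular because
  -- cuts of `G / F` vanish on `F`.
  nth_rewrite 2 [← hU]
  rw [← Matrix.det_transpose (Matrix.of fun i j => ((b' j (ε₀ i) : ℤ) : 𝕜)), ← norm_mul,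
    ← Matrix.det_mul, one_mul]
  have hV : (Matrix.of fun l i => P i (ε₀ l)) *
      (Matrix.of fun i j => P.repr (G.boundaryAway 𝕜 v₀ (γ j)) i) =
      Matrix.of fun l j => G.boundaryAway 𝕜 v₀ (γ j) (ε₀ l) := by
    ext l j
    have := congrFun (P.sum_repr (G.boundaryAway 𝕜 v₀ (γ j))) (ε₀ l)
    rw [Finset.sum_apply] at this
    rw [Matrix.mul_apply, Matrix.of_apply, ← this]
    exact Finset.sum_congr rfl fun i _ => mul_comm _ _
  have hentry : ∀ i j, ((Matrix.of fun i j => ((b' j (ε₀ i) : ℤ) : 𝕜)).transpose *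
      Matrix.of fun l j => G.boundaryAway 𝕜 v₀ (γ j) (ε₀ l)) i j =
      ∑ e, ((G.coboundary ℤ (Function.extend Subtype.val (b' i) 0) e : ℤ) : 𝕜) * γ j e := by
    intro i j
    rw [← sum_mul_boundaryAway, Matrix.mul_apply]
    exact Equiv.sum_comp ε₀ fun v => ((b' i v : ℤ) : 𝕜) * G.boundaryAway 𝕜 v₀ (γ j) v
  rw [hV, ← mul_one (Matrix.det (Matrix.of fun i j => ∑ e, (((β i : E → ℤ) e : ℤ) : 𝕜) * φ j e)),
    ← Matrix.det_one (n := ι), ← Matrix.det_fromBlocks_zero₁₂ _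
      (Matrix.of fun i j => ∑ e, ((G.coboundary ℤ
        (Function.extend Subtype.val (b' (.inr i)) 0) e : ℤ) : 𝕜) * φ j e)]
  congr 2
  ext (i | i) (j | j)
  · rw [hentry, hb1, h2]
    rfl
  · rw [hentry, hb1, h2, Matrix.fromBlocks_apply₁₂, Matrix.zero_apply]
    simp [γ, Pi.single_apply, hβ i (ε j) (ε j).2]
  · rw [hentry]
    rfl
  · rw [hentry, hb2, Matrix.fromBlocks_apply₂₂, Matrix.one_apply]
    simp [γ, Pi.single_apply, h1]

end Forests

/-- The minors are those of the quotient boundary matrix, with proportionality factor |det P|². An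
acyclic edge set of size |V| - 1 - k automatically has `k + 1` components, so all other minors
vanish. -/
theorem realStable_polyA_of_linearIndependent (hG : G.IsConnected Finset.univ) (v₀ : V) {k : ℕ}
    (φ : Fin k → E → 𝕜) (h : LinearIndependent 𝕜 fun i => G.boundaryAway 𝕜 v₀ (φ i)) :
    RealStable (G.polyA k (exteriorPower.ιMulti 𝕜 k φ)) := by
  classical
  let P := Module.Basis.sumExtend h
  have : Finite (Fin k ⊕ Module.Basis.sumExtendIndex h) := Module.Finite.finite_basis P
  have : Finite (Module.Basis.sumExtendIndex h) := Finite.sum_right (Fin k)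
  have : Fintype (Module.Basis.sumExtendIndex h) := Fintype.ofFinite _
  have hcard : Fintype.card (Fin k ⊕ Module.Basis.sumExtendIndex h) =
      Fintype.card {v : V // v ≠ v₀} := by
    rw [← Module.finrank_eq_card_basis P, Module.finrank_fintype_fun_eq_card]
  let ε₀ : Fin k ⊕ Module.Basis.sumExtendIndex h ≃ {v : V // v ≠ v₀} := Fintype.equivOfCardEq hcard
  have hP : ∀ i, P (.inl i) = G.boundaryAway 𝕜 v₀ (φ i) := fun i => by
    simp only [P, Module.Basis.sumExtend, Module.Basis.reindex_apply,
      Module.Basis.extend_apply_self]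
    rfl
  have hdet : ‖(Matrix.of fun l i => P i (ε₀ l)).det‖ ≠ 0 := by
    have := ((Pi.basisFun 𝕜 _).reindex ε₀.symm).isUnit_det P
    rw [Module.Basis.det_apply] at this
    rw [norm_ne_zero_iff]
    convert! this.ne_zero using 2
  -- Makes the truncated subtraction |V| - 1 in `hcard` exact.
  have hV : 0 < Fintype.card V := Fintype.card_pos_iff.mpr ⟨v₀⟩
  rw [Fintype.card_sum, Fintype.card_fin, Fintype.card_subtype_compl, Fintype.card_subtype_eq]
    at hcard
  rw [polyA, MvPolynomial.sum_C_mul_eq_sum_ite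
    (B := Finset.univ.powersetCard (Fintype.card (Module.Basis.sumExtendIndex h))) fun F hF => by
      obtain ⟨h1, h2⟩ := G.mem_spanningForests.mp hF
      have h3 := G.card_eq_card_add_numComponents h1
      refine Finset.mem_powersetCard.mpr ⟨Finset.subset_univ F, by omega⟩]
  refine realStable_of_minors _ (linearIndependent_quotientBoundaryMatrix P hG)
    (pow_ne_zero 2 hdet) _ fun F ε => ?_
  split_ifs with hF
  · obtain ⟨h1, h2⟩ := G.mem_spanningForests.mp hF
    rw [norm_det_quotientBoundaryMatrix P hG hP ε₀ h1 h2 ε, mul_pow]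
  · rw [det_quotientBoundaryMatrix_of_cycles_ne_bot P _ ε, norm_zero, zero_pow two_ne_zero, mul_zero]
    intro h1
    refine hF (G.mem_spanningForests.mpr ⟨h1, ?_⟩)
    have h2 := Fintype.card_congr ε
    have h3 := G.card_eq_card_add_numComponents h1
    rw [Fintype.card_coe] at h2
    omega

end OrientedGraph

theorem mainTheorem12 {𝕜 : Type*} [RCLike 𝕜] {V E : Type*} [Fintype V] [Fintype E]
    [DecidableEq V] [DecidableEq E] (G : OrientedGraph V E) (hG : G.IsConnected Finset.univ)
    (k : ℕ) :
    (∀ θ : Fin k → E → 𝕜,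
      (G.polyC k (exteriorPower.ιMulti 𝕜 k θ) ≠ 0 →
        RealStable (G.polyC k (exteriorPower.ιMulti 𝕜 k θ))) ∧
      (LinearIndependent 𝕜 θ →
        Disjoint (Submodule.span 𝕜 (Set.range θ)) (LinearMap.range (G.coboundary 𝕜)) →
        RealStable (G.polyC k (exteriorPower.ιMulti 𝕜 k θ)))) ∧
    (∀ φ : Fin k → E → 𝕜,
      (G.polyA k (exteriorPower.ιMulti 𝕜 k φ) ≠ 0 →
        RealStable (G.polyA k (exteriorPower.ιMulti 𝕜 k φ))) ∧
      (LinearIndependent 𝕜 φ →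
        Disjoint (Submodule.span 𝕜 (Set.range φ)) (LinearMap.ker (G.boundary 𝕜)) →
        RealStable (G.polyA k (exteriorPower.ιMulti 𝕜 k φ)))) := by
  obtain ⟨v₀⟩ := hG.1
  refine ⟨fun θ => ⟨fun h => ?_, fun hθ hd => ?_⟩, fun φ => ⟨fun h => ?_, fun hφ hd => ?_⟩⟩
  · exact G.realStable_polyC_of_linearIndependent v₀ θ
      (G.linearIndependent_formMatrix_of_polyC_ne_zero v₀ θ h)
  · exact G.realStable_polyC_of_linearIndependent v₀ θ
      (G.linearIndependent_formMatrix hG v₀ θ hθ hd)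
  · exact G.realStable_polyA_of_linearIndependent hG v₀ φ
      (G.linearIndependent_boundaryAway_of_polyA_ne_zero hG v₀ φ h)
  · refine G.realStable_polyA_of_linearIndependent hG v₀ φ (hφ.map (f := G.boundaryAway 𝕜 v₀) ?_)
    rwa [G.ker_boundaryAway v₀]
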